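/- **Theorem 4.** Let $P(m,c)=\frac c2\{(m-2)c-(m-4)\}$ be the $c$-th $m$-gonal number. For integers $m>4$, $t\ge 1$, $n\ge 1$ let $r_{m,t}(n)$ be the number of representations $n=a+b$ (with $a\le b$ positive integers, i.e. disregarding the order of the summands) for which $ab=tP(m,c)$ for some integer $c$. For a discriminant $d<-4$ let $H(d)$ be the form class group, i.e. the group, under Gauss composition, of proper ($\mathrm{SL}_2(\mathbb Z)$-) equivalence classes of primitive positive definite integral binary quadratic forms of discriminant $d$, and for $K\in H(d)$ let $R(K,N)$ be the number of pairs $(x,y)\in\mathbb Z^2$ with $f(x,y)=N$, where $f$ is any form in $K$. If $H(d)$ is cyclic of order $4$ with identity $I$ and generator $A$, put, for $k=0,1,2,3$, $$F(A^k,N)=\frac12\sum_{s=0}^{3}\cos\frac{2\pi ks}{4}\,R(A^s,N);$$ thus $F(I,N)=\frac12\sum_{K\in H(d)}R(K,N)$, $F(A,N)=\frac12(R(I,N)-R(A^2,N))$ and $F(A^2,N)=\frac12(R(I,N)-R(A,N)+R(A^2,N)-R(A^3,N))$. (1) Let $(m,d)$ be one of $(9,-56)$, $(19,-136)$, $(25,-184)$,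 $(43,-328)$, $(73,-568)$, and let $t=1$. Then $d$ is a negative fundamental discriminant and $H(d)\cong\mathbb Z_4$. For every generator $A$ of $H(d)$ (with identity $I$) and every integer $n\ge1$, with $z=2(m-2)n^2+(m-4)^2$, $$r_{m,1}(n)=\begin{cases}\frac18\big(F(I,z)+2F(A,z)+F(A^2,z)\big)-1&\text{if } z \text{ is not a perfect square},\\[2pt] \frac18\big(F(I,z)+2F(A,z)+F(A^2,z)\big)-\frac12&\text{if } z \text{ is a perfect square}.\end{cases}$$ (2) Let $(m,d)$ be one of $(16,-56)$, $(36,-136)$, $(48,-184)$, $(84,-328)$, $(144,-568)$, and let $t=2$. Then $d$ is a negative fundamental discriminant and $H(d)\cong\mathbb Z_4$. For every generator $A$ of $H(d)$ (with identity $I$) and every integer $n\ge1$, with $z=\{(m-2)n^2+(m-4)^2\}/2$ (an integer), $$r_{m,2}(n)=\begin{cases}\frac18\big(F(I,z)-2F(A,z)+F(A^2,z)\big)-1&\text{if } 2z \text{ is not a perfect square},\\[2pt] \frac18\big(F(I,z)-2F(A,z)+F(A^2,z)\big)-\frac12&\text{if } 2z \text{ is a perfect square}.\end{cases}$$ -/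

import Mathlib

/-- A primitive, positive definite, integral binary quadratic form
`a x² + b x y + c y²` of discriminant `d`. -/
@[ext]
structure QForm (d : ℤ) where
  a : ℤ
  b : ℤ
  c : ℤ
  disc_eq : b ^ 2 - 4 * a * c = d
  primitive : ∀ k : ℤ, k ∣ a → k ∣ b → k ∣ c → IsUnit k
  posDef : ∀ x y : ℤ, (x ≠ 0 ∨ y ≠ 0) → 0 < a * x ^ 2 + b * x * y + c * y ^ 2

namespace QForm

/-- The value of the form at `(x, y)`. -/
def eval {d : ℤ} (f : QForm d) (x y : ℤ) : ℤ :=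
  f.a * x ^ 2 + f.b * x * y + f.c * y ^ 2

/-- Proper equivalence: `g` arises from `f` by a substitution in `SL₂(ℤ)`. -/
def ProperEquiv {d : ℤ} (f g : QForm d) : Prop :=
  ∃ p q r s : ℤ, p * s - q * r = 1 ∧
    ∀ x y : ℤ, g.eval x y = f.eval (p * x + q * y) (r * x + s * y)

theorem ProperEquiv.rfl' {d : ℤ} (f : QForm d) : ProperEquiv f f :=
  ⟨1, 0, 0, 1, by norm_num, fun x y => by simp⟩

theorem ProperEquiv.symm' {d : ℤ} {f g : QForm d} (h : ProperEquiv f g) :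
    ProperEquiv g f := by
  obtain ⟨p, q, r, s, hdet, h⟩ := h
  refine ⟨s, -q, -r, p, by linarith, fun x y => ?_⟩
  rw [h]
  have h1 : p * (s * x + -q * y) + q * (-r * x + p * y) = x := by
    linear_combination x * hdet
  have h2 : r * (s * x + -q * y) + s * (-r * x + p * y) = y := by
    linear_combination y * hdet
  rw [h1, h2]

theorem ProperEquiv.trans' {d : ℤ} {f g h : QForm d} (hfg : ProperEquiv f g)
    (hgh : ProperEquiv g h) : ProperEquiv f h := by
  obtain ⟨p, q, r, s, hdet, h1⟩ := hfg
  obtain ⟨p', q', r', s', hdet', h2⟩ := hgh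
  refine ⟨p * p' + q * r', p * q' + q * s', r * p' + s * r', r * q' + s * s', ?_, ?_⟩
  · linear_combination (p' * s' - q' * r') * hdet + hdet'
  · intro x y
    rw [h2, h1]
    congr 1 <;> ring

instance properSetoid (d : ℤ) : Setoid (QForm d) where
  r := ProperEquiv
  iseqv := ⟨ProperEquiv.rfl', ProperEquiv.symm', ProperEquiv.trans'⟩

/-- The number of pairs of integers `(x, y)` at which the form takes the value `n`. -/
noncomputable def rep {d : ℤ} (f : QForm d) (n : ℤ) : ℕ :=
  Set.ncard {v : ℤ × ℤ | f.eval v.1 v.2 = n}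

theorem rep_eq_of_properEquiv {d : ℤ} {f g : QForm d} (h : ProperEquiv f g) (n : ℤ) :
    f.rep n = g.rep n := by
  obtain ⟨p, q, r, s, hdet, h⟩ := h
  unfold rep
  symm
  refine Set.ncard_congr (fun v _ => (p * v.1 + q * v.2, r * v.1 + s * v.2)) ?_ ?_ ?_
  · intro v hv
    simpa [h] using hv
  · rintro ⟨x, y⟩ ⟨x', y'⟩ _ _ hv
    simp only [Prod.mk.injEq] at hv ⊢
    obtain ⟨h1, h2⟩ := hv
    constructor
    · linear_combination s * h1 - q * h2 - (x - x') * hdet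
    · linear_combination p * h2 - r * h1 - (y - y') * hdet
  · rintro ⟨x, y⟩ hv
    have h1 : p * (s * x - q * y) + q * (p * y - r * x) = x := by
      linear_combination x * hdet
    have h2 : r * (s * x - q * y) + s * (p * y - r * x) = y := by
      linear_combination y * hdet
    refine ⟨(s * x - q * y, p * y - r * x), ?_, ?_⟩
    · simp only [Set.mem_ofPred_eq] at hv ⊢
      rw [h, h1, h2]
      exact hv
    · simp only [h1, h2]

end QForm

/-- The set `H(d)` of proper equivalence classes of primitive, positive definite,
integral binary quadratic forms of discriminant `d`. -/
def FormClass (d : ℤ) : Type := Quotient (QForm.properSetoid d)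

namespace FormClass

/-- The class `[a, b, c]` of a form. -/
def mk {d : ℤ} (f : QForm d) : FormClass d := Quotient.mk _ f

/-- `R(K, n)`: the number of representations of `n` by (any form of) the class `K`. -/
noncomputable def R {d : ℤ} (K : FormClass d) (n : ℤ) : ℕ :=
  Quotient.lift (fun f : QForm d => f.rep n)
    (fun _ _ h => QForm.rep_eq_of_properEquiv h n) K

/-- Gauss composition of classes, through concordant forms (Dirichlet): `M` is the product of `K`
and `L` when there are forms `(a, b, a' c)` in `K`, `(a', b, a c)` in `L` and `(a a', b, c)`
in `M`. -/
def IsComp {d : ℤ} (K L M : FormClass d) : Prop :=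
  ∃ f g h : QForm d, mk f = K ∧ mk g = L ∧ mk h = M ∧
    f.b = h.b ∧ g.b = h.b ∧ h.a = f.a * g.a ∧ f.c = g.a * h.c ∧ g.c = f.a * h.c

/-- `e` is an isomorphism from the additive group `G` onto the form class group `H(d)`: it is a
bijection, and the classes that are products of `e x` and `e y` under Gauss composition are exactly
the one class `e (x + y)`. -/
def IsGroupIso {d : ℤ} {G : Type*} [AddGroup G] (e : G ≃ FormClass d) : Prop :=
  ∀ (x y : G) (M : FormClass d), IsComp (e x) (e y) M ↔ M = e (x + y)

/-- The number `ω(d)`. -/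
def omega (d : ℤ) : ℕ :=
  if 0 < d then 1 else if d = -4 then 4 else if d = -3 then 6 else 2

/-- The function `F(K, n)` on a cyclic form class group of order `h` with a generator `A`. The
generator is given through the isomorphism `e` with `e s = A ^ s`; the value is
`F(A ^ k, n) = (1 / ω(d)) ∑ₛ cos (2 π k s / h) R(A ^ s, n)`.
For `h = 4` this is `(R(I, n) - R(A², n)) / ω(d)` at `K = A`. -/
noncomputable def F {d : ℤ} {h : ℕ} [NeZero h] (e : ZMod h ≃ FormClass d) (K : FormClass d)
    (n : ℤ) : ℝ :=
  (1 / (omega d : ℝ)) * ∑ s : ZMod h,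
    Real.cos (2 * Real.pi * ((e.symm K).val : ℝ) * (s.val : ℝ) / (h : ℝ)) * (R (e s) n : ℝ)

end FormClass

/-- Fundamental discriminants. -/
def IsFundamentalDiscriminant (d : ℤ) : Prop :=
  (d ≠ 1 ∧ d % 4 = 1 ∧ Squarefree d) ∨
    ∃ k : ℤ, d = 4 * k ∧ (k % 4 = 2 ∨ k % 4 = 3) ∧ Squarefree k

/-- The `c`-th `m`-gonal number `P(m, c) = (c / 2) ((m - 2) c - (m - 4))`. -/
def polygonal (m : ℕ) (c : ℤ) : ℤ :=
  c * (((m : ℤ) - 2) * c - ((m : ℤ) - 4)) / 2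

/-- The division by `2` in `polygonal` is exact. -/
theorem two_mul_polygonal (m : ℕ) (c : ℤ) :
    2 * polygonal m c = c * (((m : ℤ) - 2) * c - ((m : ℤ) - 4)) := by
  unfold polygonal
  apply Int.mul_ediv_cancel'
  have h : (2 : ℤ) ∣ c * (c - 1) := (Int.even_mul_pred_self c).two_dvd
  obtain ⟨k, hk⟩ := h
  exact ⟨((m : ℤ) - 2) * k + c, by linear_combination ((m : ℤ) - 2) * hk⟩

/-- `r_{m,t}(n)`: the number of (unordered) representations `n = a + b` with positive integers
`a ≤ b` such that `a b = t P(m, c)`, where `c` is an integer, positive if `m ≤ 4`. -/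
noncomputable def repCount (m t n : ℕ) : ℕ :=
  Set.ncard {v : ℕ × ℕ | 0 < v.1 ∧ v.1 ≤ v.2 ∧ v.1 + v.2 = n ∧
    ∃ c : ℤ, (m ≤ 4 → 0 < c) ∧ (v.1 : ℤ) * (v.2 : ℤ) = (t : ℤ) * polygonal m c}

/-!
Let `p` be an odd prime and `d = -8 p`. Completing the square turns `a + b = n`,
`a b = t P(m, c)` into a point of `x ^ 2 + 2 p y ^ 2 = z` (for `t = 1`, `m = p + 2`) or of
`2 x ^ 2 + p y ^ 2 = z` (for `t = 2`, `m = 2 p + 2`) with `y = b - a`; conversely the sign of `x`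
can be chosen so that `x = 2 p c - (p - 2)`, resp. `x = 2 p c - (p - 1)`, for an integer `c`. As
`x` never vanishes, a solution with `y ≠ 0` yields four by sign changes, and one with `y = 0`,
which exists when `z`, resp. `2 z`, is a square, only two. As the pair `(0, n)` does not count
for `r_{m,t}(n)`, this produces the corrections `-1` and `-1/2`. The two forms lie in `I` and
`A ^ 2`, and `F(I) ± 2 F(A) + F(A ^ 2)` is `2 R(I)`, resp. `2 R(A ^ 2)`.

For the class group, write `p = a ^ 2 - 2 γ ^ 2`. The class of `a x ^ 2 + 4 γ x y + 2 a y ^ 2`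
has the class of `2 x ^ 2 + p y ^ 2` as its square, hence has order four, and for the given `p`
reduction theory leaves at most four classes. Composition is compared with the group law of the
ideal class group of `ℤ[√(-2 p)]` through the map `(a, b, c) ↦ (a, b / 2 + √(-2 p))`.
-/

namespace QForm

section Equivalence

variable {d : ℤ}

theorem a_pos (f : QForm d) : 0 < f.a := by
  simpa using f.posDef 1 0 (Or.inl one_ne_zero)

theorem c_pos (f : QForm d) : 0 < f.c := by
  simpa using f.posDef 0 1 (Or.inr one_ne_zero)

theorem disc_neg (f : QForm d) : d < 0 := by
  have ha := f.a_pos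
  have h := f.posDef (-f.b) (2 * f.a) (Or.inr (by positivity))
  have h' : 0 < f.a * -d := by
    linear_combination h - f.a * f.disc_eq
  linarith [pos_of_mul_pos_right h' ha.le]

theorem eval_nonneg (f : QForm d) (x y : ℤ) : 0 ≤ f.eval x y := by
  by_cases h : x ≠ 0 ∨ y ≠ 0
  · exact (f.posDef x y h).le
  · push Not at h
    simp [eval, h.1, h.2]

theorem isUnit_of_forall_dvd_eval (f : QForm d) {k : ℤ} (h : ∀ x y, k ∣ f.eval x y) :
    IsUnit k := by
  have ha : k ∣ f.a := by simpa [eval] using h 1 0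
  have hc : k ∣ f.c := by simpa [eval] using h 0 1
  refine f.primitive k ha ?_ hc
  simpa [eval] using (h 1 1).sub (ha.add hc)

/-- The form with coefficients `a > 0`, `b`, `c`: negativity of the discriminant makes it positive
definite. -/
@[simps]
def ofPos (a b c : ℤ) (ha : 0 < a) (hd : d < 0) (hdisc : b ^ 2 - 4 * a * c = d)
    (hprim : ∀ k : ℤ, k ∣ a → k ∣ b → k ∣ c → IsUnit k) : QForm d where
  a := a
  b := b
  c := c
  disc_eq := hdisc
  primitive := hprim
  posDef x y hxy := by
    have hsq : 4 * a * (a * x ^ 2 + b * x * y + c * y ^ 2) =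
        (2 * a * x + b * y) ^ 2 + -d * y ^ 2 := by
      linear_combination -y ^ 2 * hdisc
    refine pos_of_mul_pos_right (hsq ▸ ?_) (by positivity : 0 ≤ 4 * a)
    have hd' : 0 < -d := neg_pos.2 hd
    rcases eq_or_ne y 0 with rfl | hy
    · have hx : x ≠ 0 := by simpa using hxy
      have : 2 * a * x + b * 0 ≠ 0 := by simp [ha.ne', hx]
      positivity
    · positivity

/-- The form `f (p x + q y) (r x + s y)`. -/
@[simps]
def transform (f : QForm d) (p q r s : ℤ) (hdet : p * s - q * r = 1) : QForm d where
  a := f.eval p r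
  b := 2 * f.a * p * q + f.b * (p * s + q * r) + 2 * f.c * r * s
  c := f.eval q s
  disc_eq := by
    simp only [eval]
    linear_combination (p * s - q * r) ^ 2 * f.disc_eq + d * (p * s - q * r + 1) * hdet
  primitive k ha hb hc := by
    refine f.isUnit_of_forall_dvd_eval fun x y => ?_
    have hinv : f.eval x y = f.eval p r * (s * x - q * y) ^ 2 +
        (2 * f.a * p * q + f.b * (p * s + q * r) + 2 * f.c * r * s) *
          (s * x - q * y) * (p * y - r * x) + f.eval q s * (p * y - r * x) ^ 2 := by
      simp only [eval]
      linear_combination -(f.a * x ^ 2 + f.b * x * y + f.c * y ^ 2) * (p * s - q * r + 1) * hdet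
    rw [hinv]
    exact dvd_add (dvd_add (ha.mul_right _) ((hb.mul_right _).mul_right _)) (hc.mul_right _)
  posDef x y hxy := by
    have hne : p * x + q * y ≠ 0 ∨ r * x + s * y ≠ 0 := by
      contrapose! hxy
      obtain ⟨h₁, h₂⟩ := hxy
      constructor
      · linear_combination s * h₁ - q * h₂ - x * hdet
      · linear_combination p * h₂ - r * h₁ - y * hdet
    convert f.posDef _ _ hne using 1
    simp only [eval]
    ring

theorem properEquiv_transform (f : QForm d) {p q r s : ℤ} (hdet : p * s - q * r = 1) :
    ProperEquiv f (f.transform p q r s hdet) :=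
  ⟨p, q, r, s, hdet, fun x y => by simp only [eval, transform]; ring⟩

theorem ProperEquiv.exists_eq_transform {f g : QForm d} (h : ProperEquiv f g) :
    ∃ (p q r s : ℤ) (hdet : p * s - q * r = 1), g = f.transform p q r s hdet := by
  obtain ⟨p, q, r, s, hdet, h⟩ := h
  have h₁ := h 1 0
  have h₂ := h 0 1
  have h₃ := h 1 1
  simp only [eval] at h₁ h₂ h₃
  refine ⟨p, q, r, s, hdet, QForm.ext ?_ ?_ ?_⟩ <;> simp only [transform, eval]
  · linear_combination h₁
  · linear_combination h₃ - h₁ - h₂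
  · linear_combination h₂

theorem exists_properEquiv_a_eq (f : QForm d) {x y : ℤ} (h : IsCoprime x y) :
    ∃ g : QForm d, ProperEquiv f g ∧ g.a = f.eval x y := by
  obtain ⟨u, v, huv⟩ := h
  exact ⟨_, f.properEquiv_transform (p := x) (q := -v) (r := y) (s := u)
    (by linear_combination huv), rfl⟩

theorem exists_properEquiv_b_eq (f : QForm d) {b : ℤ} (h : 2 * f.a ∣ b - f.b) :
    ∃ g : QForm d, ProperEquiv f g ∧ g.a = f.a ∧ g.b = b := by
  obtain ⟨k, hk⟩ := h
  refine ⟨_, f.properEquiv_transform (p := 1) (q := k) (r := 0) (s := 1) (by ring), ?_, ?_⟩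
  · simp [eval]
  · simp only [transform_b]
    linear_combination -hk

theorem ext_of_a_b {f g : QForm d} (ha : f.a = g.a) (hb : f.b = g.b) : f = g := by
  refine QForm.ext ha hb (mul_left_cancel₀ (mul_ne_zero four_ne_zero f.a_pos.ne') ?_)
  linear_combination (f.b + g.b) * hb - 4 * g.c * ha - f.disc_eq + g.disc_eq

theorem properEquiv_of_a_eq_of_dvd {f g : QForm d} (ha : f.a = g.a) (h : 2 * f.a ∣ g.b - f.b) :
    ProperEquiv f g := by
  obtain ⟨f', hf', ha', hb'⟩ := f.exists_properEquiv_b_eq h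
  exact ext_of_a_b (ha'.trans ha) hb' ▸ hf'

theorem properEquiv_of_c_eq_of_dvd {f g : QForm d} (hc : f.c = g.a) (h : 2 * f.c ∣ g.b + f.b) :
    ProperEquiv f g := by
  have hswap : ProperEquiv f (f.transform 0 (-1) 1 0 (by ring)) := f.properEquiv_transform _
  exact hswap.trans' (properEquiv_of_a_eq_of_dvd (by simpa [eval] using hc)
    (by simpa [eval] using h))

theorem exists_reduced (f : QForm d) :
    ∃ g : QForm d, ProperEquiv f g ∧ |g.b| ≤ g.a ∧ g.a ≤ g.c := by
  obtain ⟨g, hfg, hmin⟩ := exists_minimalFor_of_wellFoundedLT (fun g : QForm d => ProperEquiv f g)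
    (fun g => g.a.toNat) ⟨f, ProperEquiv.rfl' f⟩
  have ha := g.a_pos
  obtain ⟨h, hgh, hha, hhb⟩ := g.exists_properEquiv_b_eq (b := g.b.bmod (2 * g.a).toNat) (by
    simpa [ha.le] using Int.dvd_bmod_sub_self (x := g.b) (m := (2 * g.a).toNat))
  refine ⟨h, hfg.trans' hgh, ?_, ?_⟩
  · have hlow := Int.le_bmod (x := g.b) (m := (2 * g.a).toNat) (by omega)
    have hupp := Int.bmod_lt (x := g.b) (m := (2 * g.a).toNat) (by omega)
    rw [hhb, hha, abs_le]
    omega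
  · have hswap : ProperEquiv f (h.transform 0 (-1) 1 0 (by ring)) :=
      (hfg.trans' hgh).trans' (h.properEquiv_transform _)
    have hle := hmin hswap
    simp only [transform_a, eval, hha] at hle ⊢
    have := h.c_pos
    omega

end Equivalence

end QForm

theorem exists_ne_zero_forall_prime_dvd_iff {n : ℤ} (hn : n ≠ 0) (P : ℕ → Prop) :
    ∃ x : ℤ, x ≠ 0 ∧ ∀ q : ℤ, Prime q → (q ∣ x ↔ q ∣ n ∧ P q.natAbs) := by
  classical
  let S := n.natAbs.primeFactors.filter P
  have hS : ∀ p ∈ S, p.Prime := fun p hp =>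
    Nat.prime_of_mem_primeFactors (Finset.mem_of_mem_filter p hp)
  refine ⟨(∏ p ∈ S, p : ℕ), ?_, fun q hq => ?_⟩
  · exact_mod_cast Finset.prod_ne_zero_iff.2 fun p hp => (hS p hp).ne_zero
  · have hq' := Int.prime_iff_natAbs_prime.1 hq
    have hmem : q.natAbs ∣ ∏ p ∈ S, p ↔ q.natAbs ∈ S := by
      rw [hq'.prime.dvd_finsetProd_iff]
      constructor
      · rintro ⟨p, hp, h⟩
        exact (Nat.prime_dvd_prime_iff_eq hq' (hS p hp)).1 h ▸ hp
      · exact fun h => ⟨_, h, dvd_rfl⟩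
    rw [Int.dvd_natCast, hmem, Finset.mem_filter, Nat.mem_primeFactors, Int.natAbs_dvd_natAbs]
    simp [hq', hn]

namespace QForm

section Composition

variable {d : ℤ}

theorem two_dvd_b_sub_b (f g : QForm d) : 2 ∣ g.b - f.b := by
  refine Int.prime_two.dvd_of_dvd_pow (n := 2)
    ⟨2 * (g.a * g.c - f.a * f.c) - f.b * (g.b - f.b), ?_⟩
  linear_combination g.disc_eq - f.disc_eq

/-- A form of the principal class, which is the identity of the class group: a form that
represents `1`. -/
def IsPrincipal (f : QForm d) : Prop := ∃ x y : ℤ, f.eval x y = 1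

theorem isPrincipal_of_a_eq_one {f : QForm d} (h : f.a = 1) : f.IsPrincipal :=
  ⟨1, 0, by simp [eval, h]⟩

theorem isPrincipal_of_c_eq_one {f : QForm d} (h : f.c = 1) : f.IsPrincipal :=
  ⟨0, 1, by simp [eval, h]⟩

theorem IsPrincipal.of_properEquiv {f g : QForm d} (hf : f.IsPrincipal)
    (hfg : ProperEquiv f g) : g.IsPrincipal := by
  obtain ⟨x, y, hxy⟩ := hf
  obtain ⟨p, q, r, s, -, h⟩ := hfg.symm'
  exact ⟨_, _, (h x y).symm.trans hxy⟩

theorem IsPrincipal.exists_properEquiv_a_eq_one {f : QForm d} (hf : f.IsPrincipal) :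
    ∃ g : QForm d, ProperEquiv f g ∧ g.a = 1 := by
  obtain ⟨x, y, hxy⟩ := hf
  have hcop : IsCoprime x y :=
    ⟨f.a * x + f.b * y, f.c * y, by simp only [eval] at hxy; linear_combination hxy⟩
  obtain ⟨g, hfg, hg⟩ := f.exists_properEquiv_a_eq hcop
  exact ⟨g, hfg, hg.trans hxy⟩

theorem IsPrincipal.properEquiv {f g : QForm d} (hf : f.IsPrincipal) (hg : g.IsPrincipal) :
    ProperEquiv f g := by
  obtain ⟨f', hff', hf'⟩ := hf.exists_properEquiv_a_eq_one
  obtain ⟨g', hgg', hg'⟩ := hg.exists_properEquiv_a_eq_one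
  have : ProperEquiv f' g' := properEquiv_of_a_eq_of_dvd (hf'.trans hg'.symm) (by
    simpa [hf'] using two_dvd_b_sub_b f' g')
  exact hff'.trans' (this.trans' hgg'.symm')

/-- The form `(c, b, a)`, whose class is the inverse of the class of `f = (a, b, c)`. -/
@[simps!]
def flip (f : QForm d) : QForm d :=
  ofPos f.c f.b f.a f.c_pos f.disc_neg (by linear_combination f.disc_eq)
    fun k ha hb hc => f.primitive k hc hb ha

/-- The forms `f = (a, b, a' c)` and `g = (a', b, a c)` are concordant, and `h = (a a', b, c)` is
their Dirichlet composite. -/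
structure IsConcordant (f g h : QForm d) : Prop where
  b_left : f.b = h.b
  b_right : g.b = h.b
  a_eq : h.a = f.a * g.a
  c_left : f.c = g.a * h.c
  c_right : g.c = f.a * h.c

theorem exists_isConcordant {f g : QForm d} {k : ℤ} (hb : f.b = g.b) (hf : f.c = g.a * k)
    (hg : g.c = f.a * k) : ∃ h : QForm d, IsConcordant f g h ∧ h.c = k := by
  refine ⟨ofPos (f.a * g.a) f.b k (mul_pos f.a_pos g.a_pos) f.disc_neg
    (by linear_combination f.disc_eq + 4 * f.a * hf) fun l ha hlb hlk => ?_,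
    ⟨rfl, hb.symm, rfl, hf, hg⟩, rfl⟩
  by_contra hl
  obtain ⟨q, hq, hql⟩ := Int.exists_prime_and_dvd (mt Int.isUnit_iff_natAbs_eq.2 hl)
  have hqk : q ∣ k := hql.trans hlk
  have hqb : q ∣ f.b := hql.trans hlb
  rcases hq.dvd_or_dvd (hql.trans ha) with h | h
  · exact hq.not_isUnit (f.primitive q h hqb (hf ▸ hqk.mul_left _))
  · exact hq.not_isUnit (g.primitive q h (hb ▸ hqb) (hg ▸ hqk.mul_left _))

theorem exists_isConcordant_flip (f : QForm d) :
    ∃ h : QForm d, IsConcordant f f.flip h ∧ h.c = 1 :=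
  exists_isConcordant rfl (by simp) (by simp)

theorem exists_isConcordant_of_isCoprime {f g : QForm d} (hb : f.b = g.b)
    (h : IsCoprime f.a g.a) : ∃ h : QForm d, IsConcordant f g h := by
  have hac : f.a * f.c = g.a * g.c := by
    refine mul_left_cancel₀ (four_ne_zero (α := ℤ)) ?_
    linear_combination (f.b + g.b) * hb - f.disc_eq + g.disc_eq
  obtain ⟨k, hk⟩ := h.symm.dvd_of_dvd_mul_left ⟨g.c, hac⟩
  have hg : g.c = f.a * k :=
    mul_left_cancel₀ g.a_pos.ne' (by linear_combination f.a * hk - hac)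
  obtain ⟨h, hfgh, -⟩ := exists_isConcordant hb hk hg
  exact ⟨h, hfgh⟩

theorem exists_isCoprime_eval (f : QForm d) {n : ℤ} (hn : n ≠ 0) :
    ∃ x y : ℤ, IsCoprime x y ∧ IsCoprime (f.eval x y) n := by
  obtain ⟨x, hx, dvd_x⟩ := exists_ne_zero_forall_prime_dvd_iff hn
    fun p => p ∣ f.a.natAbs ∧ ¬ p ∣ f.c.natAbs
  obtain ⟨y, -, dvd_y⟩ := exists_ne_zero_forall_prime_dvd_iff hn fun p => ¬ p ∣ f.a.natAbs
  simp only [Int.natAbs_dvd_natAbs] at dvd_x dvd_y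
  have hxy : IsCoprime x y := isCoprime_of_prime_dvd (fun h => hx h.1)
    fun q hq hqx hqy => ((dvd_y q hq).1 hqy).2 ((dvd_x q hq).1 hqx).2.1
  refine ⟨x, y, hxy, isCoprime_of_prime_dvd (fun h => hn h.2) fun q hq hqe hqn => ?_⟩
  by_cases ha : q ∣ f.a
  · by_cases hc : q ∣ f.c
    · have heval : f.eval x y = (f.a * x ^ 2 + f.c * y ^ 2) + f.b * (x * y) := by
        simp only [eval]
        ring
      have hbxy : q ∣ f.b * (x * y) :=
        (dvd_add_right ((ha.mul_right _).add (hc.mul_right _))).1 (heval ▸ hqe)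
      rcases hq.dvd_or_dvd hbxy with hb | hxy'
      · exact hq.not_isUnit (f.primitive q ha hb hc)
      · rcases hq.dvd_or_dvd hxy' with hqx | hqy
        · exact ((dvd_x q hq).1 hqx).2.2 hc
        · exact ((dvd_y q hq).1 hqy).2 ha
    · have hqx : q ∣ x := (dvd_x q hq).2 ⟨hqn, ha, hc⟩
      have heval : f.eval x y = x * (f.a * x + f.b * y) + f.c * y ^ 2 := by
        simp only [eval]
        ring
      have hcy : q ∣ f.c * y ^ 2 := (dvd_add_right (hqx.mul_right _)).1 (heval ▸ hqe)
      exact ((dvd_y q hq).1 (hq.dvd_of_dvd_pow ((hq.dvd_or_dvd hcy).resolve_left hc))).2 ha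
  · have hqy : q ∣ y := (dvd_y q hq).2 ⟨hqn, ha⟩
    have heval : f.eval x y = y * (f.b * x + f.c * y) + f.a * x ^ 2 := by
      simp only [eval]
      ring
    have hax : q ∣ f.a * x ^ 2 := (dvd_add_right (hqy.mul_right _)).1 (heval ▸ hqe)
    exact ha ((dvd_x q hq).1 (hq.dvd_of_dvd_pow ((hq.dvd_or_dvd hax).resolve_left ha))).2.1

theorem exists_properEquiv_isCoprime_a (f : QForm d) {n : ℤ} (hn : n ≠ 0) :
    ∃ g : QForm d, ProperEquiv f g ∧ IsCoprime g.a n := by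
  obtain ⟨x, y, hxy, hcop⟩ := f.exists_isCoprime_eval hn
  obtain ⟨g, hfg, hg⟩ := f.exists_properEquiv_a_eq hxy
  exact ⟨g, hfg, hg ▸ hcop⟩

theorem exists_properEquiv_isConcordant (f g : QForm d) :
    ∃ f' g' h : QForm d, ProperEquiv f f' ∧ ProperEquiv g g' ∧ IsConcordant f' g' h := by
  obtain ⟨g₁, hg₁, u, v, huv⟩ := g.exists_properEquiv_isCoprime_a f.a_pos.ne'
  obtain ⟨m, hm⟩ := two_dvd_b_sub_b f g₁
  obtain ⟨f', hff', hfa, hfb⟩ := f.exists_properEquiv_b_eq (b := f.b + 2 * f.a * (v * m))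
    ⟨v * m, by ring⟩
  obtain ⟨g', hgg', hga, hgb⟩ := g₁.exists_properEquiv_b_eq (b := f.b + 2 * f.a * (v * m))
    ⟨-(u * m), by linear_combination 2 * m * huv - hm⟩
  obtain ⟨h, hh⟩ := exists_isConcordant_of_isCoprime (hfb.trans hgb.symm)
    ⟨v, u, by rw [hfa, hga]; linear_combination huv⟩
  exact ⟨f', g', h, hff', hg₁.trans' hgg', hh⟩

end Composition

end QForm

namespace FormClass

section Composition

variable {d : ℤ}

theorem mk_eq_mk_iff {f g : QForm d} : mk f = mk g ↔ QForm.ProperEquiv f g := Quotient.eq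

theorem mk_surjective : Function.Surjective (mk (d := d)) := Quotient.mk_surjective

theorem isComp_of_isConcordant {f g h : QForm d} (H : QForm.IsConcordant f g h) :
    IsComp (mk f) (mk g) (mk h) :=
  ⟨f, g, h, rfl, rfl, rfl, H.b_left, H.b_right, H.a_eq, H.c_left, H.c_right⟩

theorem exists_isComp (K L : FormClass d) : ∃ M, IsComp K L M := by
  obtain ⟨f, rfl⟩ := mk_surjective K
  obtain ⟨g, rfl⟩ := mk_surjective L
  obtain ⟨f', g', h, hf, hg, H⟩ := QForm.exists_properEquiv_isConcordant f g
  exact ⟨mk h, mk_eq_mk_iff.2 hf ▸ mk_eq_mk_iff.2 hg ▸ isComp_of_isConcordant H⟩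

end Composition

end FormClass

open scoped nonZeroDivisors

theorem isDomain_zsqrtd_of_neg {D : ℤ} (hD : D < 0) : IsDomain (ℤ√D) :=
  have : NoZeroDivisors (ℤ√D) := ⟨fun {x y} h => by
    rwa [← Zsqrtd.norm_eq_zero_iff hD, Zsqrtd.norm_mul, mul_eq_zero,
      Zsqrtd.norm_eq_zero_iff hD, Zsqrtd.norm_eq_zero_iff hD] at h⟩
  NoZeroDivisors.to_isDomain _

theorem exists_bezout_three {a b c : ℤ} (h : ∀ k : ℤ, k ∣ a → k ∣ b → k ∣ c → IsUnit k) :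
    ∃ u v w : ℤ, u * a + v * b + w * c = 1 := by
  have hcop : IsCoprime (gcd a b) c := isRelPrime_iff_isCoprime.1 fun k hk hkc =>
    h k (hk.trans (gcd_dvd_left a b)) (hk.trans (gcd_dvd_right a b)) hkc
  obtain ⟨s, w, hsw⟩ := hcop
  obtain ⟨u, v, huv⟩ := exists_gcd_eq_mul_add_mul a b
  exact ⟨s * u, s * v, w, by rw [huv] at hsw; linear_combination hsw⟩

theorem span_singleton_mul_span_pair {R : Type*} [CommRing R] (x u v : R) :
    Ideal.span {x} * Ideal.span {u, v} = Ideal.span {x * u, x * v} := by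
  rw [Ideal.span_mul_span', Set.singleton_mul, Set.image_pair]

theorem span_pair_eq_of_det_eq_one {R : Type*} [CommRing R] {p q r s : R}
    (h : p * s - q * r = 1) (u v : R) :
    Ideal.span {p * u + r * v, q * u + s * v} = Ideal.span {u, v} := by
  apply le_antisymm <;>
    simp only [Ideal.span_le, Set.pair_subset_iff, SetLike.mem_coe, Ideal.mem_span_pair]
  · exact ⟨⟨p, r, rfl⟩, ⟨q, s, rfl⟩⟩
  · exact ⟨⟨s, -r, by linear_combination u * h⟩, ⟨-q, p, by linear_combination v * h⟩⟩

namespace QForm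

section Ideal

variable {D : ℤ}

theorem two_mul_half_b (f : QForm (4 * D)) : 2 * (f.b / 2) = f.b :=
  Int.mul_ediv_cancel' <| Int.prime_two.dvd_of_dvd_pow (n := 2)
    ⟨2 * (D + f.a * f.c), by linear_combination f.disc_eq⟩

theorem half_b_sq (f : QForm (4 * D)) : (f.b / 2) ^ 2 = D + f.a * f.c := by
  refine mul_left_cancel₀ (four_ne_zero (α := ℤ)) ?_
  linear_combination f.disc_eq + (2 * (f.b / 2) + f.b) * f.two_mul_half_b

/-- The element `b / 2 + √D` of `ℤ√D`; division by `a` makes it, up to sign and conjugation, the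
root of the form `(a, b, c)`. -/
@[simps]
def root (f : QForm (4 * D)) : ℤ√D := ⟨f.b / 2, 1⟩

theorem root_eq_add {f g : QForm (4 * D)} {k : ℤ} (h : g.b = f.b + 2 * k) :
    g.root = f.root + k := by
  have hf := f.two_mul_half_b
  have hg := g.two_mul_half_b
  ext <;> simp only [root, Zsqrtd.re_add, Zsqrtd.im_add, Zsqrtd.re_intCast, Zsqrtd.im_intCast] <;>
    omega

theorem root_sq (f : QForm (4 * D)) : f.root ^ 2 = f.b * f.root - f.a * f.c := by
  rw [← f.two_mul_half_b]
  ext <;> simp only [pow_two, Zsqrtd.re_mul, Zsqrtd.im_mul, Zsqrtd.re_sub, Zsqrtd.im_sub, root_re,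
    root_im, Zsqrtd.re_intCast, Zsqrtd.im_intCast, mul_one, one_mul, mul_zero, zero_mul, add_zero,
    sub_zero, Int.cast_mul, Int.cast_ofNat, Zsqrtd.re_ofNat, Zsqrtd.im_ofNat, Nat.cast_ofNat]
  · linear_combination -f.half_b_sq
  · ring

theorem norm_add_mul_root (f : QForm (4 * D)) (x y : ℤ) :
    (x * f.a + y * f.root : ℤ√D).norm = f.a * f.eval x y := by
  simp only [Zsqrtd.norm_def, Zsqrtd.re_add, Zsqrtd.im_add, Zsqrtd.re_mul, Zsqrtd.im_mul, root_re,
    root_im, Zsqrtd.re_intCast, Zsqrtd.im_intCast, mul_one, mul_zero, zero_mul, add_zero, zero_add,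
    eval]
  linear_combination y ^ 2 * f.half_b_sq + f.a * x * y * f.two_mul_half_b

/-- The ideal `(a, b / 2 + √D)` of `ℤ√D` attached to the form `(a, b, c)` of discriminant `4 D`. -/
def ideal (f : QForm (4 * D)) : Ideal (ℤ√D) := Ideal.span {(f.a : ℤ√D), f.root}

theorem mem_ideal (f : QForm (4 * D)) {z : ℤ√D} :
    z ∈ f.ideal ↔ ∃ x y : ℤ, (x * f.a + y * f.root : ℤ√D) = z := by
  rw [ideal, Ideal.mem_span_pair]
  constructor
  · rintro ⟨u, v, rfl⟩
    refine ⟨u.re - u.im * (f.b / 2) - v.im * f.c, v.re + u.im * f.a + v.im * (f.b / 2), ?_⟩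
    ext <;> simp only [Int.cast_sub, Int.cast_mul, Int.cast_add, Zsqrtd.re_add, Zsqrtd.im_add,
      Zsqrtd.re_mul, Zsqrtd.im_mul, Zsqrtd.re_sub, Zsqrtd.im_sub, Zsqrtd.re_intCast,
      Zsqrtd.im_intCast, root_re, root_im, mul_one, mul_zero, zero_mul, add_zero, zero_add,
      sub_self]
    · linear_combination v.im * f.half_b_sq
    · ring
  · rintro ⟨x, y, rfl⟩
    exact ⟨x, y, rfl⟩

theorem ideal_eq_top_of_a_eq_one {f : QForm (4 * D)} (h : f.a = 1) : f.ideal = ⊤ :=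
  (Ideal.eq_top_iff_one _).2 (Ideal.subset_span (by simp [h]))

theorem ideal_eq_span_root_of_c_eq_one {f : QForm (4 * D)} (h : f.c = 1) :
    f.ideal = Ideal.span {f.root} := by
  have hc : (f.c : ℤ√D) = 1 := by exact_mod_cast h
  have ha : (f.a : ℤ√D) ∈ Ideal.span {f.root} := Ideal.mem_span_singleton.2
    ⟨f.b - f.root, by linear_combination f.root_sq - f.a * hc⟩
  exact Submodule.span_insert_eq_span ha

theorem IsConcordant.ideal_mul {f g h : QForm (4 * D)} (H : IsConcordant f g h) :
    f.ideal * g.ideal = h.ideal := by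
  obtain ⟨u, v, w, huvw⟩ := exists_bezout_three (a := f.a) (b := g.a) (c := f.b)
    fun k h1 h2 h3 => f.primitive k h1 h3 (H.c_left ▸ h2.mul_right _)
  have hbez : (u * f.a + v * g.a + w * f.b : ℤ√D) = 1 := by exact_mod_cast huvw
  have hf : f.root = h.root := by simp [root, H.b_left]
  have hg : g.root = h.root := by simp [root, H.b_right]
  have hsq : h.root * h.root = f.b * h.root - f.a * g.a * h.c := by
    rw [H.b_left, ← pow_two, h.root_sq, H.a_eq, Int.cast_mul]
  simp only [ideal, hf, hg, H.a_eq, Ideal.span_pair_mul_span_pair, Int.cast_mul]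
  generalize h.root = θ at *
  apply le_antisymm
  · simp only [Ideal.span_le, Set.insert_subset_iff, Set.singleton_subset_iff, SetLike.mem_coe,
      Ideal.mem_span_pair]
    exact ⟨⟨1, 0, by ring⟩, ⟨0, f.a, by ring⟩, ⟨0, g.a, by ring⟩, ⟨-h.c, f.b, by rw [hsq]; ring⟩⟩
  · simp only [Ideal.span_le, Set.pair_subset_iff, SetLike.mem_coe]
    have hθ : θ = u * (f.a * θ) + v * (θ * g.a) + w * (θ * θ + h.c * (f.a * g.a)) := by
      linear_combination -θ * hbez - w * hsq
    set J := Ideal.span {(f.a * g.a : ℤ√D), f.a * θ, θ * g.a, θ * θ}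
    have h₁ : (f.a * g.a : ℤ√D) ∈ J := Ideal.subset_span (by simp)
    have h₂ : f.a * θ ∈ J := Ideal.subset_span (by simp)
    have h₃ : θ * g.a ∈ J := Ideal.subset_span (by simp)
    have h₄ : θ * θ ∈ J := Ideal.subset_span (by simp)
    refine ⟨h₁, ?_⟩
    rw [hθ]
    exact add_mem (add_mem (J.mul_mem_left _ h₂) (J.mul_mem_left _ h₃))
      (J.mul_mem_left _ (add_mem h₄ (J.mul_mem_left _ h₁)))

theorem ProperEquiv.exists_span_mul_ideal_eq {f g : QForm (4 * D)} (h : ProperEquiv f g) :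
    ∃ x y : ℤ√D, x ≠ 0 ∧ y ≠ 0 ∧ Ideal.span {x} * f.ideal = Ideal.span {y} * g.ideal := by
  obtain ⟨p, q, r, s, hdet, rfl⟩ := h.exists_eq_transform
  have hroot : (f.transform p q r s hdet).root =
      f.root + (p * q * f.a + q * r * f.b + r * s * f.c : ℤ) :=
    root_eq_add (by simp only [transform_b]; linear_combination f.b * hdet)
  have hdet' : (p * s - q * r : ℤ√D) = 1 := by exact_mod_cast hdet
  have ha' := (f.transform p q r s hdet).a_pos.ne'
  have hmul : (p * f.a + r * (f.b - f.root)) * (p * f.a + r * f.root) =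
      (f.a * (f.transform p q r s hdet).a : ℤ√D) := by
    simp only [transform_a, eval]
    push_cast
    linear_combination -(r ^ 2 : ℤ√D) * f.root_sq
  refine ⟨p * f.a + r * (f.b - f.root), f.a, fun h0 => ?_, by exact_mod_cast f.a_pos.ne', ?_⟩
  · rw [h0, zero_mul] at hmul
    exact mul_ne_zero f.a_pos.ne' ha' (by exact_mod_cast hmul.symm)
  · rw [ideal, ideal, ← span_pair_eq_of_det_eq_one hdet', span_singleton_mul_span_pair,
      span_singleton_mul_span_pair, hmul, hroot]
    congr 2
    congr 1
    push_cast
    linear_combination -(r * s : ℤ√D) * f.root_sq + f.a * f.root * hdet'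

theorem isPrincipal_of_ideal_eq_span {f : QForm (4 * D)} {γ : ℤ√D}
    (h : f.ideal = Ideal.span {γ}) : f.IsPrincipal := by
  obtain ⟨x, y, hγ⟩ := f.mem_ideal.1 (h ▸ Ideal.mem_span_singleton_self γ)
  have hdvd (u v : ℤ) : f.eval x y ∣ f.eval u v := by
    obtain ⟨η, hη⟩ := Ideal.mem_span_singleton.1 (h ▸ f.mem_ideal.2 ⟨u, v, rfl⟩)
    have hnorm := congrArg Zsqrtd.norm hη
    rw [Zsqrtd.norm_mul, ← hγ, norm_add_mul_root, norm_add_mul_root, mul_assoc] at hnorm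
    exact ⟨η.norm, mul_left_cancel₀ f.a_pos.ne' hnorm⟩
  have hunit : IsUnit (f.eval x y) := f.isUnit_of_forall_dvd_eval hdvd
  exact ⟨x, y, (Int.isUnit_iff.1 hunit).resolve_right fun h => by
    linarith [f.eval_nonneg x y]⟩

theorem root_ne_zero (f : QForm (4 * D)) : f.root ≠ 0 := fun h => by
  simpa using congrArg Zsqrtd.im h

variable [IsDomain (ℤ√D)]

theorem isUnit_ideal (f : QForm (4 * D)) :
    IsUnit (f.ideal : FractionalIdeal (ℤ√D)⁰ (FractionRing (ℤ√D))) := by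
  obtain ⟨h, H, hc⟩ := f.exists_isConcordant_flip
  refine isUnit_of_mul_isUnit_left (y := (f.flip.ideal : FractionalIdeal _ _)) ?_
  rw [← FractionalIdeal.coeIdeal_mul, H.ideal_mul, ideal_eq_span_root_of_c_eq_one hc]
  exact .of_mul_eq_one _ (FractionalIdeal.coe_ideal_span_singleton_mul_inv _ h.root_ne_zero)

/-- The class of the ideal `f.ideal` in the Picard group of the order `ℤ√D`. -/
noncomputable def toClassGroup (f : QForm (4 * D)) : ClassGroup (ℤ√D) :=
  ClassGroup.mk (FractionRing (ℤ√D)) f.isUnit_ideal.unit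

theorem ProperEquiv.toClassGroup_eq {f g : QForm (4 * D)} (h : ProperEquiv f g) :
    f.toClassGroup = g.toClassGroup :=
  (ClassGroup.mk_eq_mk_of_coe_ideal f.isUnit_ideal.unit_spec g.isUnit_ideal.unit_spec).2
    h.exists_span_mul_ideal_eq

theorem IsConcordant.toClassGroup_mul {f g h : QForm (4 * D)} (H : IsConcordant f g h) :
    f.toClassGroup * g.toClassGroup = h.toClassGroup := by
  rw [toClassGroup, toClassGroup, ← map_mul, toClassGroup]
  congr 1
  ext1
  simp [← FractionalIdeal.coeIdeal_mul, H.ideal_mul]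

theorem toClassGroup_eq_one_iff {f : QForm (4 * D)} : f.toClassGroup = 1 ↔ f.IsPrincipal := by
  constructor
  · intro h
    obtain ⟨γ, -, hγ⟩ := (ClassGroup.mk_eq_one_of_coe_ideal f.isUnit_ideal.unit_spec).1 h
    exact isPrincipal_of_ideal_eq_span hγ
  · intro hf
    obtain ⟨g, hfg, hg⟩ := hf.exists_properEquiv_a_eq_one
    rw [hfg.toClassGroup_eq]
    exact (ClassGroup.mk_eq_one_of_coe_ideal g.isUnit_ideal.unit_spec).2
      ⟨1, one_ne_zero, by rw [ideal_eq_top_of_a_eq_one hg, Ideal.span_singleton_one]⟩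

end Ideal

end QForm

namespace QForm

theorem properEquiv_flip_of_b_eq_zero {d : ℤ} {f : QForm d} (hb : f.b = 0) :
    ProperEquiv f f.flip :=
  properEquiv_of_c_eq_of_dvd rfl (by simp [hb])

end QForm

namespace FormClass

section GroupIso

variable {d : ℤ} {G : Type*} [AddGroup G]

theorem IsGroupIso.apply_zero {e : G ≃ FormClass d} (he : IsGroupIso e) {f : QForm d}
    (hf : f.IsPrincipal) : e 0 = mk f := by
  obtain ⟨g, hfg, hg⟩ := hf.exists_properEquiv_a_eq_one
  obtain ⟨x, hx⟩ := e.surjective (mk g)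
  have hcomp : IsComp (e x) (e x) (e x) := by
    rw [hx]
    exact isComp_of_isConcordant ⟨rfl, rfl, by simp [hg], by simp [hg], by simp [hg]⟩
  have hx0 : x = 0 := left_eq_add.1 (e.injective ((he x x (e x)).1 hcomp))
  rw [← hx0, hx, mk_eq_mk_iff.2 hfg]

theorem IsGroupIso.add_self_eq_zero {e : G ≃ FormClass d} (he : IsGroupIso e) {f : QForm d}
    (hb : f.b = 0) {x : G} (hx : e x = mk f) : x + x = 0 := by
  obtain ⟨h, H, hc⟩ := f.exists_isConcordant_flip
  have hcomp : IsComp (e x) (e x) (mk h) := by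
    have hflip : mk f.flip = mk f := (mk_eq_mk_iff.2 (QForm.properEquiv_flip_of_b_eq_zero hb)).symm
    simpa only [hx, hflip] using isComp_of_isConcordant H
  refine e.injective (((he x x _).1 hcomp).symm.trans ?_)
  exact (he.apply_zero (QForm.isPrincipal_of_c_eq_one hc)).symm

theorem IsGroupIso.apply_two {e : ZMod 4 ≃ FormClass d} (he : IsGroupIso e) {f : QForm d}
    (hb : f.b = 0) (hf : ¬ f.IsPrincipal) : e 2 = mk f := by
  obtain ⟨x, hx⟩ := e.surjective (mk f)
  have hxx : x + x = 0 := he.add_self_eq_zero hb hx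
  have hx0 : x ≠ 0 := by
    rintro rfl
    obtain ⟨h, -, hc⟩ := f.exists_isConcordant_flip
    have hh := QForm.isPrincipal_of_c_eq_one hc
    exact hf (hh.of_properEquiv (mk_eq_mk_iff.1 ((he.apply_zero hh).symm.trans hx)))
  have : ∀ x : ZMod 4, x + x = 0 → x ≠ 0 → x = 2 := by decide
  rw [← this x hxx hx0, hx]

end GroupIso

section ToClassGroup

variable {D : ℤ} [IsDomain (ℤ√D)]

/-- The homomorphism from the form class group of discriminant `4 D` to the Picard group of the
order `ℤ√D` that sends the class of a form to the class of its ideal. -/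
noncomputable def toClassGroup (K : FormClass (4 * D)) : ClassGroup (ℤ√D) :=
  Quotient.lift QForm.toClassGroup (fun _ _ h => QForm.ProperEquiv.toClassGroup_eq h) K

theorem IsComp.toClassGroup_mul {K L M : FormClass (4 * D)} (H : IsComp K L M) :
    K.toClassGroup * L.toClassGroup = M.toClassGroup := by
  obtain ⟨f, g, h, rfl, rfl, rfl, h₁, h₂, h₃, h₄, h₅⟩ := H
  exact QForm.IsConcordant.toClassGroup_mul ⟨h₁, h₂, h₃, h₄, h₅⟩

theorem exists_isGroupIso_of_toClassGroup_eq_pow {n : ℕ} [NeZero n] {x : ClassGroup (ℤ√D)}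
    (hx : orderOf x = n) {K : ZMod n → FormClass (4 * D)}
    (hK : ∀ k, (K k).toClassGroup = x ^ k.val) (hsurj : Function.Surjective K) :
    ∃ e : ZMod n ≃ FormClass (4 * D), IsGroupIso e := by
  have hinj : ∀ i j, (K i).toClassGroup = (K j).toClassGroup → i = j := fun i j hij => by
    rw [hK, hK] at hij
    exact ZMod.val_injective n
      (pow_injOn_Iio_orderOf (hx ▸ i.val_lt) (hx ▸ j.val_lt) hij)
  have hmod (k : ℕ) : x ^ (k % n) = x ^ k := hx ▸ pow_mod_orderOf x k
  have hcomp : ∀ i j M, IsComp (K i) (K j) M → M = K (i + j) := fun i j M hM => by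
    obtain ⟨k, rfl⟩ := hsurj M
    congr 1
    apply hinj
    rw [← hM.toClassGroup_mul, hK, hK, hK, ZMod.val_add, hmod, pow_add]
  refine ⟨Equiv.ofBijective K ⟨fun i j hij => hinj i j (congrArg _ hij), hsurj⟩,
    fun i j M => ⟨hcomp i j M, ?_⟩⟩
  rintro rfl
  obtain ⟨M, hM⟩ := exists_isComp (K i) (K j)
  obtain rfl := hcomp i j M hM
  exact hM

end ToClassGroup

end FormClass

namespace QForm

section ToClassGroup

variable {D : ℤ} [IsDomain (ℤ√D)]

theorem toClassGroup_flip (f : QForm (4 * D)) : f.flip.toClassGroup = f.toClassGroup⁻¹ := by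
  obtain ⟨h, H, hc⟩ := f.exists_isConcordant_flip
  rw [eq_inv_iff_mul_eq_one, mul_comm, H.toClassGroup_mul, toClassGroup_eq_one_iff]
  exact isPrincipal_of_c_eq_one hc

theorem toClassGroup_sq_eq_one_of_b_eq_zero {f : QForm (4 * D)} (hb : f.b = 0) :
    f.toClassGroup ^ 2 = 1 := by
  have h := (properEquiv_flip_of_b_eq_zero hb).toClassGroup_eq
  rwa [toClassGroup_flip, eq_inv_iff_mul_eq_one, ← pow_two] at h

end ToClassGroup

end QForm

section NegTwoMul

variable {p a γ : ℤ}

namespace QForm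

/-- The form `x² + 2 p y²`. -/
@[simps!]
def oneForm (hp : 0 < p) : QForm (4 * (-2 * p)) :=
  ofPos 1 0 (2 * p) one_pos (by linarith) (by ring) fun _ h _ _ => isUnit_of_dvd_one h

/-- The form `2 x² + p y²`. -/
@[simps!]
def twoForm (hp : 0 < p) (hodd : Odd p) : QForm (4 * (-2 * p)) :=
  ofPos 2 0 p two_pos (by linarith) (by ring) fun _ h _ h' =>
    (Int.isCoprime_two_left.2 hodd).isUnit_of_dvd' h h'

/-- The form `a x² + 4 γ x y + 2 a y²` attached to a representation `p = a² - 2 γ²`; its class has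
order `4`. -/
@[simps!]
def fourForm (hp : 0 < p) (ha : 0 < a) (h : a ^ 2 - 2 * γ ^ 2 = p) (hcop : IsCoprime a (4 * γ)) :
    QForm (4 * (-2 * p)) :=
  ofPos a (4 * γ) (2 * a) ha (by linarith) (by linear_combination -8 * h) fun _ h h' _ =>
    hcop.isUnit_of_dvd' h h'

theorem isPrincipal_oneForm (hp : 0 < p) : (oneForm hp).IsPrincipal :=
  isPrincipal_of_a_eq_one rfl

theorem not_isPrincipal_twoForm (hp : 0 < p) (hp1 : p ≠ 1) (hodd : Odd p) :
    ¬ (twoForm hp hodd).IsPrincipal := by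
  rintro ⟨x, y, h⟩
  simp only [eval, twoForm_a, twoForm_b, twoForm_c] at h
  rcases eq_or_ne y 0 with rfl | hy
  · omega
  · have hpy : p * 1 ≤ p * y ^ 2 := mul_le_mul_of_nonneg_left (sq_pos_of_ne_zero hy) hp.le
    have hx : 0 ≤ x ^ 2 := sq_nonneg x
    omega

section Order

variable [IsDomain (ℤ√(-2 * p))]

theorem toClassGroup_fourForm_sq (hp : 0 < p) (hodd : Odd p) (ha : 0 < a)
    (h : a ^ 2 - 2 * γ ^ 2 = p) (hcop : IsCoprime a (4 * γ)) :
    (fourForm hp ha h hcop).toClassGroup ^ 2 = (twoForm hp hodd).toClassGroup := by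
  set f := fourForm hp ha h hcop
  obtain ⟨g, H, hg⟩ : ∃ g, IsConcordant f f g ∧ g.c = 2 :=
    exists_isConcordant rfl (mul_comm 2 a) (mul_comm 2 a)
  have hgb : g.b = 4 * γ := H.b_left.symm
  rw [pow_two, H.toClassGroup_mul]
  exact (properEquiv_of_c_eq_of_dvd hg ⟨γ, by simp [hg, hgb]⟩).toClassGroup_eq

theorem orderOf_toClassGroup_fourForm (hp : 0 < p) (hp1 : p ≠ 1) (hodd : Odd p) (ha : 0 < a)
    (h : a ^ 2 - 2 * γ ^ 2 = p) (hcop : IsCoprime a (4 * γ)) :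
    orderOf (fourForm hp ha h hcop).toClassGroup = 4 := by
  have hsq := toClassGroup_fourForm_sq hp hodd ha h hcop
  refine orderOf_eq_prime_pow (p := 2) (n := 1) ?_ ?_
  · rw [pow_one, hsq, toClassGroup_eq_one_iff]
    exact not_isPrincipal_twoForm hp hp1 hodd
  · rw [pow_succ, pow_one, pow_mul, hsq]
    exact toClassGroup_sq_eq_one_of_b_eq_zero rfl

end Order

theorem properEquiv_of_reduced (hp : 0 < p) (hodd : Odd p) (ha : 0 < a)
    (h : a ^ 2 - 2 * γ ^ 2 = p) (hcop : IsCoprime a (4 * γ))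
    (hred : ∀ α β : ℤ, 0 < α → 2 * |β| ≤ α → α ^ 2 ≤ 2 * p + β ^ 2 → α ∣ 2 * p + β ^ 2 →
      α = 1 ∨ α = 2 ∧ 2 ∣ β ∨ α = a ∧ (a ∣ β - 2 * γ ∨ a ∣ β + 2 * γ))
    (f : QForm (4 * (-2 * p))) :
    ProperEquiv (oneForm hp) f ∨ ProperEquiv (fourForm hp ha h hcop) f ∨
      ProperEquiv (twoForm hp hodd) f ∨ ProperEquiv (fourForm hp ha h hcop).flip f := by
  obtain ⟨g, hfg, hb, hac⟩ := f.exists_reduced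
  have hgf := hfg.symm'
  have hhalf := g.two_mul_half_b
  have hprod : g.a * g.c = 2 * p + (g.b / 2) ^ 2 := by linear_combination -g.half_b_sq
  have hle : g.a ^ 2 ≤ 2 * p + (g.b / 2) ^ 2 := by
    rw [← hprod, pow_two]
    exact mul_le_mul_of_nonneg_left hac g.a_pos.le
  have hb' : 2 * |g.b / 2| ≤ g.a := by
    rwa [← hhalf, abs_mul, abs_two] at hb
  rcases hred g.a (g.b / 2) g.a_pos hb' hle ⟨g.c, hprod.symm⟩ with
    hg | ⟨hg, k, hk⟩ | ⟨hg, ⟨k, hk⟩ | ⟨k, hk⟩⟩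
  · exact .inl (((isPrincipal_oneForm hp).properEquiv (isPrincipal_of_a_eq_one hg)).trans' hgf)
  · refine .inr (.inr (.inl (.trans' (properEquiv_of_a_eq_of_dvd hg.symm ⟨k, ?_⟩) hgf)))
    simp only [twoForm_a, twoForm_b]
    omega
  · refine .inr (.inl (.trans' (properEquiv_of_a_eq_of_dvd hg.symm ⟨k, ?_⟩) hgf))
    simp only [fourForm_a, fourForm_b]
    linear_combination 2 * hk - hhalf
  · refine .inr (.inr (.inr (.trans' (properEquiv_of_c_eq_of_dvd hg.symm ⟨k, ?_⟩) hgf)))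
    simp only [flip_b, flip_c, fourForm_a, fourForm_b]
    linear_combination 2 * hk - hhalf

end QForm

namespace FormClass

theorem exists_isGroupIso_of_reduced (hp : 0 < p) (hp1 : p ≠ 1) (hodd : Odd p) (ha : 0 < a)
    (h : a ^ 2 - 2 * γ ^ 2 = p) (hcop : IsCoprime a (4 * γ))
    (hred : ∀ α β : ℤ, 0 < α → 2 * |β| ≤ α → α ^ 2 ≤ 2 * p + β ^ 2 → α ∣ 2 * p + β ^ 2 →
      α = 1 ∨ α = 2 ∧ 2 ∣ β ∨ α = a ∧ (a ∣ β - 2 * γ ∨ a ∣ β + 2 * γ)) :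
    ∃ e : ZMod 4 ≃ FormClass (4 * (-2 * p)), IsGroupIso e := by
  have : IsDomain (ℤ√(-2 * p)) := isDomain_zsqrtd_of_neg (by linarith)
  let f := QForm.fourForm hp ha h hcop
  have hf : orderOf f.toClassGroup = 4 :=
    QForm.orderOf_toClassGroup_fourForm hp hp1 hodd ha h hcop
  let K : ZMod 4 → FormClass (4 * (-2 * p)) :=
    ![mk (QForm.oneForm hp), mk f, mk (QForm.twoForm hp hodd), mk f.flip]
  have hK : ∀ k, (K k).toClassGroup = f.toClassGroup ^ k.val := by
    have hflip : f.flip.toClassGroup = f.toClassGroup ^ 3 := by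
      rw [QForm.toClassGroup_flip, inv_eq_iff_mul_eq_one, ← pow_succ']
      exact orderOf_dvd_iff_pow_eq_one.1 hf.dvd
    intro k
    fin_cases k
    · exact (QForm.toClassGroup_eq_one_iff.2 (QForm.isPrincipal_oneForm hp)).trans (pow_zero _).symm
    · exact (pow_one _).symm
    · exact (QForm.toClassGroup_fourForm_sq hp hodd ha h hcop).symm
    · exact hflip
  refine exists_isGroupIso_of_toClassGroup_eq_pow hf hK fun L => ?_
  obtain ⟨g, rfl⟩ := mk_surjective L
  rcases QForm.properEquiv_of_reduced hp hodd ha h hcop hred g with hg | hg | hg | hg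
  exacts [⟨0, mk_eq_mk_iff.2 hg⟩, ⟨1, mk_eq_mk_iff.2 hg⟩, ⟨2, mk_eq_mk_iff.2 hg⟩,
    ⟨3, mk_eq_mk_iff.2 hg⟩]

theorem exists_isGroupIso_of_le (hp1 : 1 < p) (hle : p ≤ 72) (hodd : Odd p) (ha : 0 < a)
    (h : a ^ 2 - 2 * γ ^ 2 = p) (hcop : IsCoprime a (4 * γ))
    (hred : ∀ α ∈ Finset.Icc (1 : ℤ) 13, ∀ β ∈ Finset.Icc (-6 : ℤ) 6, α ∣ 2 * p + β ^ 2 →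
      2 * |β| ≤ α → α ^ 2 ≤ 2 * p + β ^ 2 →
      α = 1 ∨ α = 2 ∧ 2 ∣ β ∨ α = a ∧ (a ∣ β - 2 * γ ∨ a ∣ β + 2 * γ)) :
    ∃ e : ZMod 4 ≃ FormClass (4 * (-2 * p)), IsGroupIso e := by
  refine exists_isGroupIso_of_reduced (by linarith) hp1.ne' hodd ha h hcop
    fun α β hα hβ hαβ hdvd => ?_
  have hsq : 4 * β ^ 2 ≤ α ^ 2 := by
    have := pow_le_pow_left₀ (by positivity) hβ 2
    rwa [mul_pow, sq_abs] at this
  -- A reduced form has `3 * α ^ 2 ≤ 8 * p ≤ 576 < 3 * 14 ^ 2`.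
  have hα13 : α ≤ 13 := by
    by_contra! h14
    have := pow_le_pow_left₀ (by norm_num) (Int.add_one_le_of_lt h14) 2
    linarith
  have hβ6 : -6 ≤ β ∧ β ≤ 6 := abs_le.1 (by omega)
  exact hred α (Finset.mem_Icc.2 ⟨hα, hα13⟩) β (Finset.mem_Icc.2 hβ6) hdvd hβ hαβ

theorem exists_isGroupIso_of_mem {p : ℕ} (hp : p ∈ ({7, 17, 23, 41, 71} : Set ℕ)) :
    ∃ e : ZMod 4 ≃ FormClass (4 * (-2 * p)), IsGroupIso e := by
  rcases hp with rfl | rfl | rfl | rfl | rfl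
  · exact exists_isGroupIso_of_le (a := 3) (γ := 1) (by norm_num) (by norm_num) (by decide)
      (by norm_num) (by norm_num) (by norm_num) (by decide)
  · exact exists_isGroupIso_of_le (a := 5) (γ := 2) (by norm_num) (by norm_num) (by decide)
      (by norm_num) (by norm_num) (by norm_num) (by decide)
  · exact exists_isGroupIso_of_le (a := 5) (γ := 1) (by norm_num) (by norm_num) (by decide)
      (by norm_num) (by norm_num) (by norm_num) (by decide)
  · exact exists_isGroupIso_of_le (a := 7) (γ := 2) (by norm_num) (by norm_num) (by decide)
      (by norm_num) (by norm_num) (by norm_num) (by decide)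
  · exact exists_isGroupIso_of_le (a := 11) (γ := 5) (by norm_num) (by norm_num) (by decide)
      (by norm_num) (by norm_num) (by norm_num) (by decide)

end FormClass

end NegTwoMul

theorem isFundamentalDiscriminant_four_mul_neg_two_mul {p : ℕ} (hp : p.Prime) (hodd : Odd p) :
    IsFundamentalDiscriminant (4 * (-2 * p)) := by
  obtain ⟨r, hr⟩ := hodd
  refine .inr ⟨-2 * p, rfl, .inl (by omega), ?_⟩
  have hsf : Squarefree (2 * p) := (Nat.squarefree_mul (by simp [hr])).2
    ⟨Nat.prime_two.squarefree, hp.squarefree⟩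
  rw [← Int.squarefree_natAbs, Int.natAbs_mul]
  exact hsf

namespace FormClass

variable {d : ℤ} (e : ZMod 4 ≃ FormClass d)

theorem F_apply (hd : d < -4) (k : ZMod 4) (z : ℤ) :
    F e (e k) z = 1 / 2 * (R (e 0) z + Real.cos (k.val * (Real.pi / 2)) * (R (e 1) z + R (e 3) z) +
      Real.cos (k.val * Real.pi) * R (e 2) z) := by
  have hω : omega d = 2 := by
    rw [omega, if_neg (by omega), if_neg (by omega), if_neg (by omega)]
  have hsum : ∀ g : ZMod 4 → ℝ, ∑ s, g s = g 0 + g 1 + g 2 + g 3 := Fin.sum_univ_four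
  have h₁ : 2 * Real.pi * k.val * 1 / 4 = k.val * (Real.pi / 2) := by ring
  have h₂ : 2 * Real.pi * k.val * 2 / 4 = k.val * Real.pi := by ring
  have h₃ : 2 * Real.pi * k.val * 3 / 4 = k.val * (2 * Real.pi) - k.val * (Real.pi / 2) := by ring
  have v₀ : (0 : ZMod 4).val = 0 := rfl
  have v₁ : (1 : ZMod 4).val = 1 := rfl
  have v₂ : (2 : ZMod 4).val = 2 := rfl
  have v₃ : (3 : ZMod 4).val = 3 := rfl
  simp only [F, hω, hsum, Equiv.symm_apply_apply, v₀, v₁, v₂, v₃, Nat.cast_zero, Nat.cast_one,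
    Nat.cast_ofNat, mul_zero, zero_div, Real.cos_zero, h₁, h₂, h₃, Real.cos_nat_mul_two_pi_sub]
  ring

theorem F_apply_zero (hd : d < -4) (z : ℤ) :
    F e (e 0) z = 1 / 2 * (R (e 0) z + R (e 1) z + R (e 2) z + R (e 3) z) := by
  rw [F_apply e hd, ZMod.val_zero, Nat.cast_zero, zero_mul, zero_mul, Real.cos_zero]
  ring

theorem F_apply_one (hd : d < -4) (z : ℤ) :
    F e (e 1) z = 1 / 2 * (R (e 0) z - R (e 2) z) := by
  have v₁ : (1 : ZMod 4).val = 1 := rfl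
  rw [F_apply e hd, v₁, Nat.cast_one, one_mul, one_mul, Real.cos_pi_div_two, Real.cos_pi]
  ring

theorem F_apply_two (hd : d < -4) (z : ℤ) :
    F e (e 2) z = 1 / 2 * (R (e 0) z - R (e 1) z + R (e 2) z - R (e 3) z) := by
  have v₂ : (2 : ZMod 4).val = 2 := rfl
  rw [F_apply e hd, v₂, Nat.cast_ofNat, mul_div_cancel₀ _ two_ne_zero, Real.cos_pi,
    Real.cos_two_pi]
  ring

theorem R_mk_of_b_eq_zero {f : QForm d} (hb : f.b = 0) (z : ℤ) :
    R (mk f) z = {v : ℤ × ℤ | f.a * v.1 ^ 2 + f.c * v.2 ^ 2 = z}.ncard := by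
  change f.rep z = _
  simp only [QForm.rep, QForm.eval, hb, zero_mul, add_zero]

end FormClass

section Counting

theorem ncard_add_ite_eq_two_mul_ncard_natCast {s : Set ℤ} (hs : s.Finite) (hneg : ∀ y ∈ s, -y ∈ s)
    {P : Prop} [Decidable P] (hP : P ↔ 0 ∈ s) :
    s.ncard + (if P then 1 else 0) = 2 * {y : ℕ | (y : ℤ) ∈ s}.ncard := by
  set t := {y : ℕ | (y : ℤ) ∈ s}
  have ht : t.Finite := hs.preimage Nat.cast_injective.injOn
  have hunion : s = (fun y : ℕ => (y : ℤ)) '' t ∪ (fun y : ℕ => -(y : ℤ)) '' t := by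
    ext y
    constructor
    · intro hy
      rcases Int.eq_nat_or_neg y with ⟨k, rfl | rfl⟩
      · exact .inl ⟨k, hy, rfl⟩
      · exact .inr ⟨k, by simpa [t] using hneg _ hy, rfl⟩
    · rintro (⟨k, hk, rfl⟩ | ⟨k, hk, rfl⟩)
      exacts [hk, hneg _ hk]
  have hinter : (fun y : ℕ => (y : ℤ)) '' t ∩ (fun y : ℕ => -(y : ℤ)) '' t =
      if P then {0} else ∅ := by
    ext y
    have hy0 : (∃ k ∈ t, (k : ℤ) = y) → (∃ k ∈ t, -(k : ℤ) = y) → y = 0 ∧ P := by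
      rintro ⟨k, hk, rfl⟩ ⟨l, -, hl⟩
      obtain rfl : k = 0 := by omega
      exact ⟨rfl, hP.2 hk⟩
    split_ifs with h0
    · exact ⟨fun h => (hy0 h.1 h.2).1, by rintro rfl; exact ⟨⟨0, hP.1 h0, rfl⟩, 0, hP.1 h0, rfl⟩⟩
    · exact ⟨fun h => h0 (hy0 h.1 h.2).2, False.elim⟩
  have hcard := Set.ncard_union_add_ncard_inter ((fun y : ℕ => (y : ℤ)) '' t)
    ((fun y : ℕ => -(y : ℤ)) '' t) (ht.image _) (ht.image _)
  rw [← hunion, hinter, Set.ncard_image_of_injective _ Nat.cast_injective,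
    Set.ncard_image_of_injective t fun _ _ h => Nat.cast_injective (neg_injective h),
    ← two_mul] at hcard
  rw [← hcard, apply_ite Set.ncard, Set.ncard_singleton, Set.ncard_empty]

theorem ncard_diagonal {α γ z : ℤ} (hα : α ≠ 0) (hx : ∀ y : ℤ, γ * y ^ 2 ≠ z) :
    {v : ℤ × ℤ | α * v.1 ^ 2 + γ * v.2 ^ 2 = z}.ncard =
      2 * {y : ℤ | ∃ x : ℤ, α * x ^ 2 + γ * y ^ 2 = z}.ncard := by
  set T := {y : ℤ | ∃ x : ℤ, α * x ^ 2 + γ * y ^ 2 = z}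
  have hsel : ∀ y : ℤ, ∃ x : ℤ, y ∈ T → α * x ^ 2 + γ * y ^ 2 = z := fun y => by
    by_cases hy : y ∈ T
    · exact hy.imp fun x hxy _ => hxy
    · exact ⟨0, fun h => absurd h hy⟩
  choose x hxT using hsel
  have hx0 : ∀ y ∈ T, x y ≠ 0 := fun y hy h0 => hx y (by simpa [h0] using hxT y hy)
  let φ : ℤ × ℤ → ℤ × ℤ := fun v => (v.1 * x v.2, v.2)
  have hφ : Set.InjOn φ (({1, -1} : Set ℤ) ×ˢ T) := by
    rintro ⟨ε, y⟩ ⟨-, hy⟩ ⟨ε', y'⟩ - h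
    obtain ⟨hε, rfl⟩ := Prod.mk.injEq .. ▸ h
    exact Prod.ext (mul_right_cancel₀ (hx0 y hy) hε) rfl
  have himage : {v : ℤ × ℤ | α * v.1 ^ 2 + γ * v.2 ^ 2 = z} = φ '' (({1, -1} : Set ℤ) ×ˢ T) := by
    ext ⟨u, y⟩
    constructor
    · intro (h : α * u ^ 2 + γ * y ^ 2 = z)
      have hy : y ∈ T := ⟨u, h⟩
      have husq : u ^ 2 = x y ^ 2 := mul_left_cancel₀ hα (by linarith [hxT y hy])
      rcases sq_eq_sq_iff_eq_or_eq_neg.1 husq with rfl | rfl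
      · exact ⟨(1, y), ⟨by simp, hy⟩, by simp [φ]⟩
      · exact ⟨(-1, y), ⟨by simp, hy⟩, by simp [φ]⟩
    · rintro ⟨⟨ε, y⟩, ⟨rfl | rfl, hy⟩, ⟨⟩⟩
      · simpa using hxT y hy
      · simpa using hxT y hy
  rw [himage, hφ.ncard_image, Set.ncard_prod, Set.ncard_pair (by norm_num)]

end Counting

section Polygonal

theorem polygonal_nonneg {m : ℕ} (hm : 4 < m) (c : ℤ) : 0 ≤ polygonal m c := by
  have : (4 : ℤ) < m := by exact_mod_cast hm
  suffices 0 ≤ c * (((m : ℤ) - 2) * c - ((m : ℤ) - 4)) by linarith [two_mul_polygonal m c]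
  rcases le_or_gt c 0 with hc | hc
  · have hmc := mul_nonpos_of_nonneg_of_nonpos (show 0 ≤ (m : ℤ) - 2 by linarith) hc
    exact mul_nonneg_of_nonpos_of_nonpos hc (by linarith)
  · have hmc := le_mul_of_one_le_right (show 0 ≤ (m : ℤ) - 2 by linarith) hc
    exact mul_nonneg hc.le (by linarith)

theorem polygonal_zero (m : ℕ) : polygonal m 0 = 0 := by
  simp [polygonal]

theorem sq_sub_sq_eq_four_mul_iff {n y : ℕ} {k : ℤ} (hk : 0 ≤ k) :
    (n : ℤ) ^ 2 - (y : ℤ) ^ 2 = 4 * k ↔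
      ∃ a b : ℕ, a ≤ b ∧ a + b = n ∧ (a : ℤ) * b = k ∧ b - a = y := by
  constructor
  · intro h
    have hyn : y ≤ n := by
      have : (y : ℤ) ^ 2 ≤ (n : ℤ) ^ 2 := by linarith
      exact_mod_cast (sq_le_sq₀ (by positivity) (by positivity)).1 this
    obtain ⟨j, hj⟩ : Even (n - y) := by
      have heven : Even ((n : ℤ) ^ 2 - (y : ℤ) ^ 2) := ⟨2 * k, by rw [h]; ring⟩
      rw [Nat.even_sub hyn]
      simpa [Int.even_sub, Int.even_pow] using heven
    obtain rfl : n = 2 * j + y := by omega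
    refine ⟨j, j + y, by omega, by ring, ?_, by omega⟩
    push_cast at h ⊢
    linarith
  · rintro ⟨a, b, hab, rfl, rfl, rfl⟩
    push_cast [hab]
    ring

theorem ncard_exists_sq_sub_sq_eq {m : ℕ} (hm : 4 < m) (t n : ℕ) :
    {y : ℕ | ∃ c : ℤ, (n : ℤ) ^ 2 - (y : ℤ) ^ 2 = 4 * (t * polygonal m c)}.ncard =
      repCount m t n + 1 := by
  set T := {v : ℕ × ℕ | 0 < v.1 ∧ v.1 ≤ v.2 ∧ v.1 + v.2 = n ∧
    ∃ c : ℤ, (m ≤ 4 → 0 < c) ∧ (v.1 : ℤ) * (v.2 : ℤ) = (t : ℤ) * polygonal m c}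
  let U := {v : ℕ × ℕ | v.1 ≤ v.2 ∧ v.1 + v.2 = n ∧ ∃ c : ℤ, (v.1 : ℤ) * v.2 = t * polygonal m c}
  have hTU : insert (0, n) T = U := by
    ext ⟨a, b⟩
    constructor
    · rintro (⟨⟨⟩⟩ | ⟨-, hab, hn, c, -, hc⟩)
      · exact ⟨n.zero_le, n.zero_add, 0, by simp [polygonal_zero]⟩
      · exact ⟨hab, hn, c, hc⟩
    · rintro ⟨hab, hn, c, hc⟩
      rcases a.eq_zero_or_pos with rfl | ha
      · exact .inl (Prod.ext rfl (b.zero_add.symm.trans hn))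
      · exact .inr ⟨ha, hab, hn, c, fun h => absurd h hm.not_ge, hc⟩
  have hT : T.Finite := by
    refine (Set.finite_Iic (n, n)).subset ?_
    rintro ⟨a, b⟩ ⟨-, -, hn, -⟩
    exact ⟨(Nat.le_add_right a b).trans_eq hn, (Nat.le_add_left b a).trans_eq hn⟩
  have hinj : Set.InjOn (fun v : ℕ × ℕ => v.2 - v.1) U := by
    rintro ⟨a, b⟩ ⟨hab, hn, -⟩ ⟨a', b'⟩ ⟨hab', hn', -⟩ h
    simp only [Prod.mk.injEq] at hab hn hab' hn' h ⊢
    omega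
  have himage : {y : ℕ | ∃ c : ℤ, (n : ℤ) ^ 2 - (y : ℤ) ^ 2 = 4 * (t * polygonal m c)} =
      (fun v : ℕ × ℕ => v.2 - v.1) '' U := by
    ext y
    have hP (c : ℤ) : 0 ≤ (t : ℤ) * polygonal m c :=
      mul_nonneg t.cast_nonneg (polygonal_nonneg hm c)
    simp only [Set.mem_ofPred_eq, sq_sub_sq_eq_four_mul_iff (hP _), Set.mem_image, Prod.exists, U]
    constructor
    · rintro ⟨c, a, b, hab, hn, hc, hy⟩
      exact ⟨a, b, ⟨hab, hn, c, hc⟩, hy⟩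
    · rintro ⟨a, b, ⟨hab, hn, c, hc⟩, hy⟩
      exact ⟨c, a, b, hab, hn, hc, hy⟩
  rw [himage, hinj.ncard_image, ← hTU, Set.ncard_insert_of_notMem (fun h => h.1.ne rfl) hT]
  rfl

theorem ncard_diagonal_add_ite_eq_repCount {α γ z : ℤ} {m t n : ℕ} (hα : α ≠ 0) (hm : 4 < m)
    (hx : ∀ y : ℤ, γ * y ^ 2 ≠ z)
    (hparam : ∀ y : ℤ, (∃ x : ℤ, α * x ^ 2 + γ * y ^ 2 = z) ↔
      ∃ c : ℤ, (n : ℤ) ^ 2 - y ^ 2 = 4 * (t * polygonal m c))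
    {P : Prop} [Decidable P] (hP : P ↔ ∃ x : ℤ, α * x ^ 2 = z) :
    {v : ℤ × ℤ | α * v.1 ^ 2 + γ * v.2 ^ 2 = z}.ncard + (if P then 2 else 0) =
      4 * (repCount m t n + 1) := by
  set S := {y : ℤ | ∃ x : ℤ, α * x ^ 2 + γ * y ^ 2 = z} with hS
  have hfin : S.Finite := by
    refine (Set.finite_Icc (-n : ℤ) n).subset fun y hy => abs_le.1 ?_
    obtain ⟨c, hc⟩ := (hparam y).1 hy
    have := mul_nonneg (Nat.cast_nonneg (α := ℤ) t) (polygonal_nonneg hm c)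
    exact abs_le_of_sq_le_sq (by linarith) n.cast_nonneg
  have hneg : ∀ y ∈ S, -y ∈ S := fun y hy => by simpa only [hS, Set.mem_ofPred_eq, neg_sq] using hy
  have hP0 : P ↔ 0 ∈ S := by simp [hS, hP]
  have hcard := ncard_add_ite_eq_two_mul_ncard_natCast hfin hneg hP0
  have hcount : {y : ℕ | (y : ℤ) ∈ S}.ncard = repCount m t n + 1 := by
    simpa only [hS, Set.mem_ofPred_eq, hparam] using ncard_exists_sq_sub_sq_eq hm t n
  rw [hcount] at hcard
  rw [ncard_diagonal hα hx]
  split_ifs at hcard ⊢ <;> linarith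

end Polygonal

section Parametrization

theorem exists_sq_eq_of_dvd_sq_sub_sq {p x q : ℤ} (hp : Prime p) (hodd : Odd p)
    (h : p ∣ x ^ 2 - q ^ 2) (heven : Even (x ^ 2 - q ^ 2)) : ∃ c, (2 * p * c - q) ^ 2 = x ^ 2 := by
  have hcop : IsCoprime 2 p := Int.isCoprime_two_left.2 hodd
  rw [Int.even_sub, Int.even_pow' two_ne_zero, Int.even_pow' two_ne_zero] at heven
  rw [sq_sub_sq] at h
  rcases hp.dvd_or_dvd h with h | h
  · obtain ⟨c, hc⟩ := hcop.mul_dvd (Int.even_add.2 heven).two_dvd h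
    exact ⟨c, by rw [← hc, add_sub_cancel_right]⟩
  · obtain ⟨c, hc⟩ := hcop.mul_dvd (Int.even_sub.2 heven).two_dvd h
    exact ⟨-c, by rw [mul_neg, ← hc]; ring⟩

variable {p : ℕ} (hp : p.Prime) (hodd : Odd p)
include hp hodd

theorem exists_sq_add_two_mul_sq_eq_iff (n : ℕ) (y : ℤ) :
    (∃ x : ℤ, x ^ 2 + 2 * p * y ^ 2 = 2 * p * n ^ 2 + (p - 2) ^ 2) ↔
      ∃ c : ℤ, (n : ℤ) ^ 2 - y ^ 2 = 4 * polygonal (p + 2) c := by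
  have hpoly (c : ℤ) :
      (2 * p * c - (p - 2)) ^ 2 = 8 * p * polygonal (p + 2) c + ((p : ℤ) - 2) ^ 2 := by
    have h := two_mul_polygonal (p + 2) c
    push_cast at h
    linear_combination -4 * p * h
  constructor
  · rintro ⟨x, hx⟩
    have hdiff : x ^ 2 - ((p : ℤ) - 2) ^ 2 = p * (2 * (n ^ 2 - y ^ 2)) := by linear_combination hx
    obtain ⟨c, hc⟩ := exists_sq_eq_of_dvd_sq_sub_sq (Nat.prime_iff_prime_int.1 hp)
      (Int.odd_coe_nat p |>.2 hodd) ⟨_, hdiff⟩ (hdiff ▸ (even_two_mul _).mul_left _)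
    refine ⟨c, mul_left_cancel₀ (mul_ne_zero two_ne_zero (Int.natCast_ne_zero.2 hp.ne_zero)) ?_⟩
    linear_combination hpoly c - hc - hdiff
  · rintro ⟨c, hc⟩
    refine ⟨2 * p * c - (p - 2), ?_⟩
    linear_combination hpoly c - 2 * p * hc

theorem exists_two_mul_sq_add_sq_eq_iff (n : ℕ) (y : ℤ) :
    (∃ x : ℤ, 2 * x ^ 2 + p * y ^ 2 = p * n ^ 2 + 2 * (p - 1) ^ 2) ↔
      ∃ c : ℤ, (n : ℤ) ^ 2 - y ^ 2 = 4 * (2 * polygonal (2 * p + 2) c) := by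
  have hpoly (c : ℤ) :
      (2 * p * c - (p - 1)) ^ 2 = 4 * p * polygonal (2 * p + 2) c + ((p : ℤ) - 1) ^ 2 := by
    have h := two_mul_polygonal (2 * p + 2) c
    push_cast at h
    linear_combination -2 * p * h
  constructor
  · rintro ⟨x, hx⟩
    have hpodd : Odd (p : ℤ) := Int.odd_coe_nat p |>.2 hodd
    have hdiff : 2 * (x ^ 2 - ((p : ℤ) - 1) ^ 2) = p * ((n + y) * (n - y)) := by
      linear_combination hx
    have hny : Even ((n : ℤ) - y) := by
      have h : Even ((p : ℤ) * ((n + y) * (n - y))) := hdiff ▸ even_two_mul _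
      simpa [Int.even_mul, Int.even_add, Int.even_sub, Int.not_even_iff_odd.2 hpodd] using h
    obtain ⟨j, hj⟩ := hny
    have hdiff' : x ^ 2 - ((p : ℤ) - 1) ^ 2 = p * (2 * (j * (y + j))) := by
      rw [eq_add_of_sub_eq hj] at hdiff
      linarith
    obtain ⟨c, hc⟩ := exists_sq_eq_of_dvd_sq_sub_sq (Nat.prime_iff_prime_int.1 hp) hpodd
      ⟨_, hdiff'⟩ (hdiff' ▸ (even_two_mul _).mul_left _)
    refine ⟨c, mul_left_cancel₀ (Int.natCast_ne_zero.2 hp.ne_zero) ?_⟩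
    linear_combination 2 * hpoly c - 2 * hc - hdiff
  · rintro ⟨c, hc⟩
    refine ⟨2 * p * c - (p - 1), ?_⟩
    linear_combination 2 * hpoly c - p * hc

end Parametrization

namespace FormClass

variable {p n : ℕ} (hp : p.Prime) (hodd : Odd p) {e : ZMod 4 ≃ FormClass (4 * (-2 * p))}
  (he : IsGroupIso e) {z : ℤ}
include hp hodd he

theorem IsGroupIso.R_zero_add_ite (hz : z = 2 * p * n ^ 2 + (p - 2) ^ 2) :
    R (e 0) z + (if IsSquare z then 2 else 0) = 4 * (repCount (p + 2) 1 n + 1) := by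
  have hp2 : 2 < p := hp.odd_iff.1 hodd
  have hp0 : (0 : ℤ) < p := by exact_mod_cast hp.pos
  have hx : ∀ y : ℤ, 2 * p * y ^ 2 ≠ z := by
    rintro y rfl
    have hdvd : (p : ℤ) ∣ 2 ^ 2 := ⟨2 * y ^ 2 - 2 * n ^ 2 - p + 4, by linear_combination -hz⟩
    have := Int.le_of_dvd two_pos ((Nat.prime_iff_prime_int.1 hp).dvd_of_dvd_pow hdvd)
    omega
  rw [he.apply_zero (QForm.isPrincipal_oneForm hp0), R_mk_of_b_eq_zero rfl]
  exact ncard_diagonal_add_ite_eq_repCount one_ne_zero (by omega) hx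
    (by simpa only [hz, one_mul, Nat.cast_one] using exists_sq_add_two_mul_sq_eq_iff hp hodd n)
    (by simp only [isSquare_iff_exists_sq, one_mul, eq_comm])

theorem IsGroupIso.R_two_add_ite (hz : z = p * n ^ 2 + 2 * (p - 1) ^ 2) :
    R (e 2) z + (if IsSquare (2 * z) then 2 else 0) = 4 * (repCount (2 * p + 2) 2 n + 1) := by
  have hp2 : 2 < p := hp.odd_iff.1 hodd
  have hp0 : (0 : ℤ) < p := by exact_mod_cast hp.pos
  have hoddz : Odd (p : ℤ) := Int.odd_coe_nat p |>.2 hodd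
  have hx : ∀ y : ℤ, p * y ^ 2 ≠ z := by
    rintro y rfl
    have hdvd : (p : ℤ) ∣ 2 := ⟨y ^ 2 - n ^ 2 - 2 * p + 4, by linear_combination -hz⟩
    have := Int.le_of_dvd two_pos hdvd
    omega
  have hsq : IsSquare (2 * z) ↔ ∃ x : ℤ, 2 * x ^ 2 = z := by
    rw [isSquare_iff_exists_sq]
    constructor
    · rintro ⟨w, hw⟩
      obtain ⟨x, rfl⟩ := ((Int.even_pow' two_ne_zero).1 (hw ▸ even_two_mul z)).two_dvd
      exact ⟨x, by linarith⟩
    · rintro ⟨x, rfl⟩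
      exact ⟨2 * x, by ring⟩
  rw [he.apply_two (f := QForm.twoForm hp0 hoddz) rfl
    (QForm.not_isPrincipal_twoForm hp0 (by exact_mod_cast hp.ne_one) hoddz), R_mk_of_b_eq_zero rfl]
  exact ncard_diagonal_add_ite_eq_repCount two_ne_zero (by omega) hx
    (hz ▸ exists_two_mul_sq_add_sq_eq_iff hp hodd n) hsq

theorem IsGroupIso.repCount_one_eq (hz : z = 2 * p * n ^ 2 + (p - 2) ^ 2) :
    (repCount (p + 2) 1 n : ℝ) =
      1 / 8 * (F e (e 0) z + 2 * F e (e 1) z + F e (e 2) z) - if IsSquare z then 1 / 2 else 1 := by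
  have hd : 4 * (-2 * (p : ℤ)) < -4 := by linarith [hp.pos]
  have hR := congrArg (Nat.cast (R := ℝ)) (he.R_zero_add_ite hp hodd hz)
  rw [F_apply_zero e hd, F_apply_one e hd, F_apply_two e hd]
  split_ifs at hR ⊢ <;> push_cast at hR <;> linarith

theorem IsGroupIso.repCount_two_eq (hz : z = p * n ^ 2 + 2 * (p - 1) ^ 2) :
    (repCount (2 * p + 2) 2 n : ℝ) = 1 / 8 * (F e (e 0) z - 2 * F e (e 1) z + F e (e 2) z) -
      if IsSquare (2 * z) then 1 / 2 else 1 := by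
  have hd : 4 * (-2 * (p : ℤ)) < -4 := by linarith [hp.pos]
  have hR := congrArg (Nat.cast (R := ℝ)) (he.R_two_add_ite hp hodd hz)
  rw [F_apply_zero e hd, F_apply_one e hd, F_apply_two e hd]
  split_ifs at hR ⊢ <;> push_cast at hR <;> linarith

end FormClass

theorem theorem4 :
    (∀ (m : ℕ) (d : ℤ),
      (m, d) ∈ ({(9, -56), (19, -136), (25, -184), (43, -328), (73, -568)} : Set (ℕ × ℤ)) →
      d < 0 ∧ IsFundamentalDiscriminant d ∧
      (∃ e : ZMod 4 ≃ FormClass d, FormClass.IsGroupIso e) ∧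
      ∀ e : ZMod 4 ≃ FormClass d, FormClass.IsGroupIso e →
      ∀ I A A2 : FormClass d, I = e 0 → A = e 1 → A2 = e 2 →
      ∀ n : ℕ, 0 < n →
      ∀ z : ℤ, z = 2 * ((m : ℤ) - 2) * (n : ℤ) ^ 2 + ((m : ℤ) - 4) ^ 2 →
        (¬ IsSquare z → (repCount m 1 n : ℝ) =
          1 / 8 * (FormClass.F e I z + 2 * FormClass.F e A z + FormClass.F e A2 z) - 1) ∧
        (IsSquare z → (repCount m 1 n : ℝ) =
          1 / 8 * (FormClass.F e I z + 2 * FormClass.F e A z + FormClass.F e A2 z) - 1 / 2)) ∧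
    (∀ (m : ℕ) (d : ℤ),
      (m, d) ∈ ({(16, -56), (36, -136), (48, -184), (84, -328), (144, -568)} : Set (ℕ × ℤ)) →
      d < 0 ∧ IsFundamentalDiscriminant d ∧
      (∃ e : ZMod 4 ≃ FormClass d, FormClass.IsGroupIso e) ∧
      ∀ e : ZMod 4 ≃ FormClass d, FormClass.IsGroupIso e →
      ∀ I A A2 : FormClass d, I = e 0 → A = e 1 → A2 = e 2 →
      ∀ n : ℕ, 0 < n →
      ∀ z : ℤ, 2 * z = ((m : ℤ) - 2) * (n : ℤ) ^ 2 + ((m : ℤ) - 4) ^ 2 →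
        (¬ IsSquare (2 * z) → (repCount m 2 n : ℝ) =
          1 / 8 * (FormClass.F e I z - 2 * FormClass.F e A z + FormClass.F e A2 z) - 1) ∧
        (IsSquare (2 * z) → (repCount m 2 n : ℝ) =
          1 / 8 * (FormClass.F e I z - 2 * FormClass.F e A z + FormClass.F e A2 z) - 1 / 2)) := by
  have hprime : ∀ p ∈ ({7, 17, 23, 41, 71} : Set ℕ), p.Prime ∧ Odd p := by
    rintro p (rfl | rfl | rfl | rfl | rfl) <;> exact ⟨by norm_num, by decide⟩
  constructor
  · intro m d hmd
    obtain ⟨p, hp, rfl, rfl⟩ : ∃ p ∈ ({7, 17, 23, 41, 71} : Set ℕ),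
        m = p + 2 ∧ d = 4 * (-2 * p) := by
      rcases hmd with ⟨⟨⟩⟩ | ⟨⟨⟩⟩ | ⟨⟨⟩⟩ | ⟨⟨⟩⟩ | ⟨⟨⟩⟩ <;> simp
    obtain ⟨hpp, hodd⟩ := hprime p hp
    refine ⟨by linarith [hpp.pos], isFundamentalDiscriminant_four_mul_neg_two_mul hpp hodd,
      FormClass.exists_isGroupIso_of_mem hp, ?_⟩
    rintro e he _ _ _ rfl rfl rfl n - z hz
    have h := he.repCount_one_eq (n := n) hpp hodd (hz.trans (by push_cast; ring))
    exact ⟨fun hsq => by rw [h, if_neg hsq], fun hsq => by rw [h, if_pos hsq]⟩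
  · intro m d hmd
    obtain ⟨p, hp, rfl, rfl⟩ : ∃ p ∈ ({7, 17, 23, 41, 71} : Set ℕ),
        m = 2 * p + 2 ∧ d = 4 * (-2 * p) := by
      rcases hmd with ⟨⟨⟩⟩ | ⟨⟨⟩⟩ | ⟨⟨⟩⟩ | ⟨⟨⟩⟩ | ⟨⟨⟩⟩ <;> simp
    obtain ⟨hpp, hodd⟩ := hprime p hp
    refine ⟨by linarith [hpp.pos], isFundamentalDiscriminant_four_mul_neg_two_mul hpp hodd,
      FormClass.exists_isGroupIso_of_mem hp, ?_⟩
    rintro e he _ _ _ rfl rfl rfl n - z hz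
    have h := he.repCount_two_eq (n := n) (z := z) hpp hodd (by push_cast at hz; linarith)
    exact ⟨fun hsq => by rw [h, if_neg hsq], fun hsq => by rw [h, if_pos hsq]⟩
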